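/- For integers $n \ge k \ge 1$, an $(n,k)$-Sperner partition system is a set of partitions of some $n$-element set such that each partition has exactly $k$ nonempty parts and no part in any partition is a subset of a part in a different partition. Let $\mathrm{SP}(n,k)$ denote the maximum number of partitions in an $(n,k)$-Sperner partition system. Theorem. Let $k \ge 4$ be an even integer and let $n = 3k-2$. Then $$\mathrm{SP}(n,k) \in \left\{ \binom{n/2}{2},\ \binom{n/2}{2}+1 \right\}.$$ -/

import Mathlib

/-- A collection `S` of partitions of the finite ground set `α` (into nonempty parts) is a Sperner
partition system with `k` parts per partition if every partition in `S` has exactly `k` parts and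
no part of a partition in `S` is a subset of a part of a different partition in `S`. -/
def IsSpernerPartitionSystem {α : Type*} [Fintype α] [DecidableEq α] (k : ℕ)
    (S : Finset (Finpartition (Finset.univ : Finset α))) : Prop :=
  (∀ P ∈ S, P.parts.card = k) ∧
    ∀ P ∈ S, ∀ Q ∈ S, P ≠ Q → ∀ A ∈ P.parts, ∀ B ∈ Q.parts, ¬ A ⊆ B

/-- The maximum number of partitions in an `(n,k)`-Sperner partition system, the ground set being
the `n`-element set `Fin n`. -/
noncomputable def SP (n k : ℕ) : ℕ :=
  sSup {p : ℕ | ∃ S : Finset (Finpartition (Finset.univ : Finset (Fin n))),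
    IsSpernerPartitionSystem k S ∧ S.card = p}

/-- The supremum defining `SP n k` is a maximum. -/
theorem SP_isGreatest (n k : ℕ) :
    IsGreatest {p : ℕ | ∃ S : Finset (Finpartition (Finset.univ : Finset (Fin n))),
      IsSpernerPartitionSystem k S ∧ S.card = p} (SP n k) := by
  have hfin : Finite (Finpartition (Finset.univ : Finset (Fin n))) :=
    Finite.of_injective (fun P => P.parts) (fun P Q h => Finpartition.ext h)
  have hne : {p : ℕ | ∃ S : Finset (Finpartition (Finset.univ : Finset (Fin n))),
      IsSpernerPartitionSystem k S ∧ S.card = p}.Nonempty :=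
    ⟨0, ∅, by simp [IsSpernerPartitionSystem], rfl⟩
  have hbd : BddAbove {p : ℕ | ∃ S : Finset (Finpartition (Finset.univ : Finset (Fin n))),
      IsSpernerPartitionSystem k S ∧ S.card = p} := by
    refine ⟨Nat.card (Finpartition (Finset.univ : Finset (Fin n))), ?_⟩
    rintro p ⟨S, -, rfl⟩
    have := Fintype.ofFinite (Finpartition (Finset.univ : Finset (Fin n)))
    rw [Nat.card_eq_fintype_card]
    exact Finset.card_le_univ S
  exact ⟨Nat.sSup_mem hne hbd, fun p hp => le_csSup hbd hp⟩

/-! Write $n = 2m$, so $3k = 2m+2$ and parts have average size just below 3.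

Upper bound: at a point $x$, the other points of the triples form distinct pairs that avoid every
point paired with $x$. Hence many pairs at $x$ leave room for few triples. If there were $\binom
m2+2$ partitions, this would bound the pairs at each $x$ by $m-1$ plus half the number of parts of
size at least 4 at $x$ (`two_mul_card_pairs_at_point_le`). Each partition, however, must have enough
pairs to bring its average size below 3. Weighing parts by size and summing over all points then
gives at most $\binom m2$ partitions, a contradiction (`eight_mul_card_le`).

Lower bound: $m+1$ is a multiple of 3, so `baranyai` splits the triples of $m+1$ points into $\binom
m2$ partitions. Take two copies of each, delete one point from both, and cross the two resulting
pairs between the copies (`choose_two_le_SP`). A crossed pair lies in no triple, since triples stay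
inside one copy. -/

/-! ### Baranyai's theorem, by adding points one at a time. -/

/-- The number of times a set of size `s` must occur as the trace of a block when all sets of
size `r` are used once and `a` points are still to be added. -/
def traceMultiplicity (a r s : ℕ) : ℕ := if s ≤ r then a.choose (r - s) else 0

theorem traceMultiplicity_mul_sub (a r s : ℕ) :
    traceMultiplicity (a + 1) r s * (r - s) = (a + 1) * traceMultiplicity a r (s + 1) := by
  unfold traceMultiplicity
  rcases lt_or_ge s r with h | h
  · obtain ⟨t, rfl⟩ := Nat.exists_eq_add_of_lt h
    rw [if_pos (by omega), if_pos (by omega), show s + t + 1 - s = t + 1 by omega,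
      show s + t + 1 - (s + 1) = t by omega, Nat.add_one_mul_choose_eq]
  · rw [if_neg (show ¬ s + 1 ≤ r by omega), Nat.sub_eq_zero_of_le h]
    simp

theorem traceMultiplicity_succ (a r s : ℕ) :
    traceMultiplicity (a + 1) r s = traceMultiplicity a r s + traceMultiplicity a r (s + 1) := by
  unfold traceMultiplicity
  rcases lt_trichotomy s r with h | rfl | h
  · obtain ⟨t, rfl⟩ := Nat.exists_eq_add_of_lt h
    rw [if_pos (by omega), if_pos (by omega), if_pos (by omega),
      show s + t + 1 - s = t + 1 by omega, show s + t + 1 - (s + 1) = t by omega,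
      Nat.choose_succ_succ, add_comm]
  · simp
  · rw [if_neg (by omega), if_neg (by omega), if_neg (by omega)]

open Finset in
/-- The block with label `j` in the partition of `{0, …, l - 1}` given by the labelling `f`. -/
def labelBlock {u : ℕ} (l : ℕ) (f : ℕ → Fin u) (j : Fin u) : Finset ℕ :=
  (range l).filter fun x => f x = j

theorem mem_labelBlock {u l : ℕ} {f : ℕ → Fin u} {j : Fin u} {x : ℕ} :
    x ∈ labelBlock l f j ↔ x < l ∧ f x = j := by
  simp [labelBlock]

theorem labelBlock_subset_range {u : ℕ} (l : ℕ) (f : ℕ → Fin u) (j : Fin u) :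
    labelBlock l f j ⊆ Finset.range l :=
  Finset.filter_subset _ _

theorem sum_card_labelBlock {u : ℕ} (l : ℕ) (f : ℕ → Fin u) :
    ∑ j, (labelBlock l f j).card = l := by
  have := Finset.card_eq_sum_card_fiberwise (f := f) (s := Finset.range l) (t := Finset.univ)
    (by simp)
  simpa [labelBlock] using this.symm

theorem labelBlock_update {u : ℕ} (l : ℕ) (f : ℕ → Fin u) (i j : Fin u) :
    labelBlock (l + 1) (Function.update f l i) j =
      if i = j then insert l (labelBlock l f j) else labelBlock l f j := by
  ext x
  rw [mem_labelBlock]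
  rcases eq_or_ne x l with rfl | hx
  · split_ifs with h <;> simp [h, mem_labelBlock]
  · rw [Function.update_of_ne hx]
    split_ifs with h <;> simp [hx, mem_labelBlock] <;> omega

-- Give a block $B$ the weight $(r-|B|)/(a+1)$. The weights in each partition sum to 1, and by
-- `traceMultiplicity_mul_sub` the total weight of the blocks with trace $S$ is the required count.
-- This fractional selection verifies Hall's condition, which supplies an integral one.
open Finset in
theorem exists_selection_of_block_counts {ι : Type*} [Fintype ι] {u r l a : ℕ}
    (hl : l + (a + 1) = u * r) (f : ι → ℕ → Fin u)
    (hf : ∀ S ⊆ range l, #{q : ι × Fin u | labelBlock l (f q.1) q.2 = S} =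
      traceMultiplicity (a + 1) r #S) :
    ∃ g : ι → Fin u, ∀ S ⊆ range l,
      #{i | labelBlock l (f i) (g i) = S} = traceMultiplicity a r (#S + 1) := by
  classical
  set B : ι → Fin u → Finset ℕ := fun i j => labelBlock l (f i) j with hB
  have hBl : ∀ i j, B i j ⊆ range l := fun i j => labelBlock_subset_range _ _ _
  have hle : ∀ i j, #(B i j) ≤ r := by
    intro i j
    by_contra h
    have h1 := hf (B i j) (hBl i j)
    rw [traceMultiplicity, if_neg h, card_eq_zero] at h1
    have : (i, j) ∈ ({q : ι × Fin u | labelBlock l (f q.1) q.2 = B i j} : Finset _) := by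
      simp [hB]
    rw [h1] at this
    simp at this
  have hdef : ∀ i, ∑ j, (r - #(B i j)) = a + 1 := by
    intro i
    have h1 : ∑ j, (r - #(B i j)) + ∑ j, #(B i j) = u * r := by
      rw [← sum_add_distrib, sum_congr rfl fun j _ => Nat.sub_add_cancel (hle i j)]
      simp
    have h2 : ∑ j, #(B i j) = l := sum_card_labelBlock l (f i)
    omega
  have hcount : ∀ (I : Finset ι) (N : Finset (Finset ℕ)), (∀ i ∈ I, ∀ j, B i j ∈ N) →
      #I * (a + 1) = ∑ S ∈ N, #{q ∈ I ×ˢ (univ : Finset (Fin u)) | B q.1 q.2 = S} * (r - #S) := by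
    intro I N hN
    calc #I * (a + 1) = ∑ q ∈ I ×ˢ (univ : Finset (Fin u)), (r - #(B q.1 q.2)) := by
          rw [sum_product]
          simp [hdef]
      _ = ∑ S ∈ N, ∑ q ∈ I ×ˢ (univ : Finset (Fin u)) with B q.1 q.2 = S, (r - #(B q.1 q.2)) := by
          rw [sum_fiberwise_of_maps_to]
          intro q hq
          exact hN _ (mem_product.1 hq).1 _
      _ = _ := by
          refine sum_congr rfl fun S _ => ?_
          rw [sum_congr rfl (g := fun _ => r - #S), sum_const, smul_eq_mul]
          intro q hq
          rw [(mem_filter.1 hq).2]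
  -- Each trace is offered in as many copies as it is to be selected; distinct partitions must take
  -- distinct copies.
  let t : ι → Finset ((_ : Finset ℕ) × ℕ) := fun i =>
    (univ.image (B i)).sigma fun S => range (traceMultiplicity a r (#S + 1))
  have hall : ∀ I : Finset ι, #I ≤ #(I.biUnion t) := by
    intro I
    let N : Finset (Finset ℕ) := I.biUnion fun i => univ.image (B i)
    have hNl : ∀ S ∈ N, S ⊆ range l := by
      intro S hS
      obtain ⟨i, -, hi⟩ := mem_biUnion.1 hS
      obtain ⟨j, -, rfl⟩ := mem_image.1 hi
      exact hBl i j
    have hN : I.biUnion t = N.sigma fun S => range (traceMultiplicity a r (#S + 1)) := by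
      ext ⟨S, x⟩
      simp only [t, N, mem_biUnion, mem_sigma]
      aesop
    have h1 : #I * (a + 1) ≤ (a + 1) * #(I.biUnion t) := by
      rw [hcount I N fun i hi j => mem_biUnion.2 ⟨i, hi, mem_image_of_mem _ (mem_univ j)⟩,
        hN, card_sigma, mul_sum]
      refine sum_le_sum fun S hS => ?_
      rw [card_range, ← traceMultiplicity_mul_sub, ← hf S (hNl S hS)]
      exact Nat.mul_le_mul_right _ (card_le_card (filter_subset_filter _ (subset_univ _)))
    rw [mul_comm] at h1
    exact Nat.le_of_mul_le_mul_left h1 (by omega)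
  obtain ⟨σ, hσ, hσt⟩ := (all_card_le_biUnion_card_iff_exists_injective t).1 hall
  have hg : ∀ i, ∃ j, B i j = (σ i).1 ∧ (σ i).2 < traceMultiplicity a r (#(σ i).1 + 1) := by
    intro i
    obtain ⟨h1, h2⟩ := mem_sigma.1 (hσt i)
    obtain ⟨j, -, hj⟩ := mem_image.1 h1
    exact ⟨j, hj, mem_range.1 h2⟩
  choose g hg1 hg2 using hg
  refine ⟨g, ?_⟩
  -- Hall only bounds each count from above; equal totals then force equality throughout.
  have hq : ∀ S ∈ (range l).powerset,
      #{i | B i (g i) = S} ≤ traceMultiplicity a r (#S + 1) := by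
    intro S _
    rw [← card_range (traceMultiplicity a r (#S + 1))]
    refine card_le_card_of_injOn (fun i => (σ i).2) ?_ ?_
    · intro i hi
      have hi' : B i (g i) = S := by simpa using hi
      rw [hg1] at hi'
      have := hg2 i
      rw [hi'] at this
      simpa using this
    · intro i hi i' hi' h
      have h1 : B i (g i) = S := by simpa using hi
      have h2 : B i' (g i') = S := by simpa using hi'
      rw [hg1] at h1 h2
      exact hσ (Sigma.ext (h1.trans h2.symm) (heq_of_eq h))
  have hs1 : ∑ S ∈ (range l).powerset, #{i | B i (g i) = S} = Fintype.card ι := by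
    rw [← card_eq_sum_card_fiberwise (f := fun i => B i (g i)), card_univ]
    intro i _
    exact mem_coe.2 (mem_powerset.2 (hBl i (g i)))
  have hs2 : ∑ S ∈ (range l).powerset, traceMultiplicity a r (#S + 1) = Fintype.card ι := by
    have h1 := hcount univ (range l).powerset fun i _ j => mem_powerset.2 (hBl i j)
    have h2 : (a + 1) * ∑ S ∈ (range l).powerset, traceMultiplicity a r (#S + 1) =
        (a + 1) * Fintype.card ι := by
      rw [mul_comm _ (Fintype.card ι), ← card_univ, h1, mul_sum]
      refine sum_congr rfl fun S hS => ?_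
      rw [← traceMultiplicity_mul_sub, ← hf S (mem_powerset.1 hS), univ_product_univ]
    exact Nat.eq_of_mul_eq_mul_left (by omega) h2
  intro S hS
  exact (sum_eq_sum_iff_of_le hq).1 (hs1.trans hs2.symm) S (mem_powerset.2 hS)

-- Sets containing the new point come from selected blocks, the others from unselected ones; the
-- latter count is Pascal's rule, `traceMultiplicity_succ`.
open Finset in
theorem block_counts_update {ι : Type*} [Fintype ι] {u r l a : ℕ} (f : ι → ℕ → Fin u)
    (hf : ∀ S ⊆ range l, #{q : ι × Fin u | labelBlock l (f q.1) q.2 = S} =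
      traceMultiplicity (a + 1) r #S)
    (g : ι → Fin u) (hg : ∀ S ⊆ range l,
      #{i | labelBlock l (f i) (g i) = S} = traceMultiplicity a r (#S + 1)) :
    ∀ S ⊆ range (l + 1),
      #{q : ι × Fin u | labelBlock (l + 1) (Function.update (f q.1) l (g q.1)) q.2 = S} =
        traceMultiplicity a r #S := by
  classical
  intro S hS
  have hlB : ∀ i j, l ∉ labelBlock l (f i) j := by simp [mem_labelBlock]
  simp only [labelBlock_update]
  have hgraph : ∀ S, #{q : ι × Fin u | g q.1 = q.2 ∧ labelBlock l (f q.1) q.2 = S} =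
      #{i | labelBlock l (f i) (g i) = S} := by
    intro S
    refine (card_bij (fun i _ => (i, g i)) ?_ ?_ ?_).symm
    · intro i hi
      simpa using hi
    · intro i _ i' _ h
      exact congrArg Prod.fst h
    · rintro ⟨i, j⟩ h
      obtain ⟨-, hj, h⟩ := mem_filter.1 h
      obtain rfl : g i = j := hj
      exact ⟨i, by simpa using h, rfl⟩
  by_cases hlS : l ∈ S
  · have hS' : S.erase l ⊆ range l := by
      intro x hx
      have h1 := mem_range.1 (hS (mem_of_mem_erase hx))
      have h2 := ne_of_mem_erase hx
      exact mem_range.2 (by omega)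
    have := hg _ hS'
    rw [card_erase_add_one hlS, ← hgraph] at this
    rw [← this]
    congr 1
    ext ⟨i, j⟩
    simp only [mem_filter, mem_univ, true_and]
    split_ifs with h
    · simp only [h, true_and]
      constructor
      · rintro rfl
        rw [erase_insert (hlB i j)]
      · intro h
        rw [h, insert_erase hlS]
    · simp only [h, false_and, iff_false]
      rintro rfl
      exact hlB i j hlS
  · have hS' : S ⊆ range l := by
      intro x hx
      have h1 := mem_range.1 (hS hx)
      have h2 : x ≠ l := by rintro rfl; exact hlS hx
      exact mem_range.2 (by omega)
    have h1 := hf S hS'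
    have h2 := hg S hS'
    rw [traceMultiplicity_succ, ← h2, ← hgraph] at h1
    have h3 := card_filter_add_card_filter_not (p := fun q : ι × Fin u => g q.1 = q.2)
      (s := ({q : ι × Fin u | labelBlock l (f q.1) q.2 = S} : Finset _))
    rw [filter_filter, filter_filter, h1, filter_congr (q := fun q : ι × Fin u => g q.1 = q.2 ∧
      labelBlock l (f q.1) q.2 = S) (fun _ _ => and_comm), add_comm] at h3
    rw [← Nat.add_right_cancel h3]
    congr 1
    ext ⟨i, j⟩
    simp only [mem_filter, mem_univ, true_and]
    split_ifs with h
    · simp only [h, not_true_eq_false, and_false, iff_false]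
      rintro rfl
      exact hlS (mem_insert_self _ _)
    · simp [h]

open Finset in
theorem exists_block_counts {u r : ℕ} (hu : 0 < u) (hr : 0 < r) (l a : ℕ) (hl : l + a = u * r) :
    ∃ f : Fin ((u * r - 1).choose (r - 1)) → ℕ → Fin u, ∀ S ⊆ range l,
      #{q : Fin ((u * r - 1).choose (r - 1)) × Fin u | labelBlock l (f q.1) q.2 = S} =
        traceMultiplicity a r #S := by
  induction l generalizing a with
  | zero =>
    refine ⟨fun _ _ => ⟨0, hu⟩, fun S hS => ?_⟩
    obtain rfl : S = ∅ := by simpa using hS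
    obtain rfl : a = u * r := by omega
    have h : ∀ q : Fin ((u * r - 1).choose (r - 1)) × Fin u,
        labelBlock 0 (fun _ => (⟨0, hu⟩ : Fin u)) q.2 = ∅ := by simp [labelBlock]
    rw [filter_true_of_mem fun q _ => h q]
    simp only [card_univ, Fintype.card_prod, Fintype.card_fin, card_empty, traceMultiplicity,
      zero_le, if_true, Nat.sub_zero]
    have h1 := Nat.add_one_mul_choose_eq (u * r - 1) (r - 1)
    rw [Nat.sub_add_cancel (Nat.mul_pos hu hr), Nat.sub_add_cancel hr] at h1
    refine Nat.eq_of_mul_eq_mul_right hr ?_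
    rw [← h1]
    ring
  | succ l ih =>
    obtain ⟨f, hf⟩ := ih (a + 1) (by omega)
    obtain ⟨g, hg⟩ := exists_selection_of_block_counts (by omega) f hf
    exact ⟨fun i => Function.update (f i) l (g i), block_counts_update f hf g hg⟩

open Finset in
/-- **Baranyai's theorem**: the `r`-subsets of a set of `u * r` points can be arranged into
`(u * r - 1).choose (r - 1)` partitions of the points, no subset being used twice. -/
theorem baranyai {u r : ℕ} (hu : 0 < u) (hr : 0 < r) :
    ∃ f : Fin ((u * r - 1).choose (r - 1)) → ℕ → Fin u,
      (∀ i j, #(labelBlock (u * r) (f i) j) = r) ∧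
      ∀ i j i' j', labelBlock (u * r) (f i) j = labelBlock (u * r) (f i') j' → i = i' := by
  obtain ⟨f, hf⟩ := exists_block_counts hu hr (u * r) 0 rfl
  have hcard : ∀ i j, #(labelBlock (u * r) (f i) j) = r := by
    intro i j
    by_contra h
    have h1 := hf _ (labelBlock_subset_range _ (f i) j)
    have h2 : traceMultiplicity 0 r #(labelBlock (u * r) (f i) j) = 0 := by
      unfold traceMultiplicity
      split_ifs with h3
      · exact Nat.choose_eq_zero_of_lt (by omega)
      · rfl
    rw [h2, card_eq_zero] at h1
    exact notMem_empty (i, j) (h1 ▸ mem_filter.2 ⟨mem_univ _, rfl⟩)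
  refine ⟨f, hcard, fun i j i' j' h => ?_⟩
  have h1 := hf _ (labelBlock_subset_range _ (f i) j)
  rw [hcard, traceMultiplicity, if_pos le_rfl, Nat.sub_self, Nat.choose_self] at h1
  have := card_le_one.1 h1.le (i, j) (mem_filter.2 ⟨mem_univ _, rfl⟩) (i', j')
    (mem_filter.2 ⟨mem_univ _, h.symm⟩)
  exact congrArg Prod.fst this

/-! ### Upper bound by local counting at a point. -/

namespace IsSpernerPartitionSystem

variable {α : Type*} [Fintype α] [DecidableEq α] {k : ℕ}
  {S : Finset (Finpartition (Finset.univ : Finset α))}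

theorem eq_of_part_subset (hS : IsSpernerPartitionSystem k S)
    {P Q : Finpartition (Finset.univ : Finset α)} (hP : P ∈ S) (hQ : Q ∈ S) {x : α}
    (h : P.part x ⊆ Q.part x) : P = Q := by
  by_contra hne
  exact hS.2 P hP Q hQ hne _ (P.part_mem.2 (Finset.mem_univ x)) _
    (Q.part_mem.2 (Finset.mem_univ x)) h

open Finset in
theorem two_le_card (hS : IsSpernerPartitionSystem k S) (h2 : 2 ≤ #S)
    {P : Finpartition (univ : Finset α)} (hP : P ∈ S) {A : Finset α} (hA : A ∈ P.parts) :
    2 ≤ #A := by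
  by_contra h
  have h1 : #A = 1 := by
    have := card_pos.2 (P.nonempty_of_mem_parts hA)
    omega
  obtain ⟨x, rfl⟩ := card_eq_one.1 h1
  obtain ⟨Q, hQ, hne⟩ := exists_mem_ne (s := S) (by omega) P
  exact hS.2 P hP Q hQ hne.symm _ hA _ (Q.part_mem.2 (mem_univ x))
    (singleton_subset_iff.2 (Q.mem_part (mem_univ x)))

open Finset in
/-- The triples at a point `x` use pairs of points not joined to `x` by a part of size two, and a
larger part at `x` makes at least three such pairs unavailable. -/
theorem exists_triples_at_point_le (hS : IsSpernerPartitionSystem k S) (x : α) :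
    ∃ h, h + #{P ∈ S | #(P.part x) = 2} + 1 = Fintype.card α ∧
      #{P ∈ S | #(P.part x) = 3} ≤ h.choose 2 ∧
      (0 < #{P ∈ S | 4 ≤ #(P.part x)} → 3 ≤ h ∧ #{P ∈ S | #(P.part x) = 3} + 3 ≤ h.choose 2) := by
  classical
  have hx : ∀ P : Finpartition (univ : Finset α), x ∈ P.part x := fun P =>
    P.mem_part (mem_univ x)
  have hcard : ∀ P : Finpartition (univ : Finset α), #((P.part x).erase x) + 1 = #(P.part x) :=
    fun P => card_erase_add_one (hx P)
  have hsub : ∀ P ∈ S, ∀ Q ∈ S, (P.part x).erase x ⊆ (Q.part x).erase x → P = Q := by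
    intro P hP Q hQ h
    refine hS.eq_of_part_subset hP hQ (x := x) ?_
    rw [← insert_erase (hx P), ← insert_erase (hx Q)]
    exact insert_subset_insert _ h
  set D := {P ∈ S | #(P.part x) = 2} with hD
  set T := {P ∈ S | #(P.part x) = 3} with hT
  set N : Finset α := D.biUnion fun P => (P.part x).erase x with hN
  have hsingle : ∀ P ∈ D, ∀ y ∈ (P.part x).erase x, (P.part x).erase x = {y} := by
    intro P hP y hy
    have h1 : #((P.part x).erase x) = 1 := by
      have := hcard P
      rw [(mem_filter.1 hP).2] at this
      omega
    obtain ⟨z, hz⟩ := card_eq_one.1 h1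
    rw [hz, mem_singleton] at hy
    rw [hz, hy]
  have hNcard : #N = #D := by
    rw [hN, card_biUnion]
    · rw [card_eq_sum_ones]
      refine sum_congr rfl fun P hP => ?_
      have := hcard P
      rw [(mem_filter.1 hP).2] at this
      omega
    · intro P hP Q hQ hne
      rw [Function.onFun, disjoint_left]
      intro y hy hy'
      refine hne (hsub P (mem_filter.1 hP).1 Q (mem_filter.1 hQ).1 ?_)
      rw [hsingle P hP y hy, hsingle Q hQ y hy']
  set K : Finset α := univ.erase x \ N with hK
  have hKcard : #K + #D + 1 = Fintype.card α := by
    rw [← hNcard, hK, card_sdiff_add_card_eq_card, card_erase_add_one (mem_univ x), card_univ]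
    intro y hy
    obtain ⟨P, -, hP⟩ := mem_biUnion.1 hy
    exact mem_erase.2 ⟨ne_of_mem_erase hP, mem_univ y⟩
  have hmemK : ∀ P ∈ S, #(P.part x) ≠ 2 → (P.part x).erase x ⊆ K := by
    intro P hP hP2 y hy
    refine mem_sdiff.2 ⟨mem_erase.2 ⟨ne_of_mem_erase hy, mem_univ y⟩, fun hyN => ?_⟩
    obtain ⟨Q, hQ, hyQ⟩ := mem_biUnion.1 hyN
    have : Q = P := by
      refine hsub Q (mem_filter.1 hQ).1 P hP ?_
      rw [hsingle Q hQ y hyQ]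
      exact singleton_subset_iff.2 hy
    exact hP2 (this ▸ (mem_filter.1 hQ).2)
  set E := T.image fun P => (P.part x).erase x with hE
  have hEcard : #E = #T := by
    refine card_image_of_injOn fun P hP Q hQ h => ?_
    exact hsub P (mem_filter.1 hP).1 Q (mem_filter.1 hQ).1 (subset_of_eq h)
  have hEK : E ⊆ K.powersetCard 2 := by
    intro e he
    obtain ⟨P, hP, rfl⟩ := mem_image.1 he
    have h3 := (mem_filter.1 hP).2
    have := hcard P
    exact mem_powersetCard.2 ⟨hmemK P (mem_filter.1 hP).1 (by omega), by omega⟩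
  refine ⟨#K, hKcard, ?_, fun hpos => ?_⟩
  · rw [← hEcard, ← card_powersetCard]
    exact card_le_card hEK
  · obtain ⟨Q, hQ⟩ := card_pos.1 hpos
    obtain ⟨hQS, hQ4⟩ := mem_filter.1 hQ
    have hQK := hmemK Q hQS (by omega)
    have hQc := hcard Q
    obtain ⟨C, hCQ, hC⟩ := exists_subset_card_eq (s := (Q.part x).erase x) (n := 3) (by omega)
    refine ⟨hC ▸ card_le_card (hCQ.trans hQK), ?_⟩
    have hdisj : Disjoint E (C.powersetCard 2) := by
      rw [disjoint_left]
      intro e he heC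
      obtain ⟨P, hP, rfl⟩ := mem_image.1 he
      have := hsub P (mem_filter.1 hP).1 Q hQS ((mem_powersetCard.1 heC).1.trans hCQ)
      have h3 := (mem_filter.1 hP).2
      rw [this] at h3
      omega
    calc #T + 3 = #(E ∪ C.powersetCard 2) := by
          rw [card_union_of_disjoint hdisj, hEcard, card_powersetCard, hC]
          rfl
      _ ≤ #(K.powersetCard 2) :=
          card_le_card (union_subset hEK (powersetCard_mono (hCQ.trans hQK)))
      _ = _ := card_powersetCard _ _

open Finset in
theorem two_mul_card_pairs_at_point_le (hS : IsSpernerPartitionSystem k S) {m : ℕ} (hm : 5 ≤ m)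
    (hα : Fintype.card α = 2 * m) (hcard : m.choose 2 + 2 ≤ #S) (x : α) :
    2 * #{P ∈ S | #(P.part x) = 2} ≤ #{P ∈ S | 4 ≤ #(P.part x)} + 2 * (m - 1) := by
  classical
  have hchoose : ∀ a : ℕ, 2 * (a.choose 2 : ℤ) = a * (a - 1) := by
    intro a
    induction a with
    | zero => simp
    | succ a ih =>
      rw [Nat.choose_succ_succ, Nat.choose_one_right]
      push_cast
      linarith
  obtain ⟨h, hh, hT, hL⟩ := hS.exists_triples_at_point_le x
  have hsplit : #S = #{P ∈ S | #(P.part x) = 2} + #{P ∈ S | #(P.part x) = 3} +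
      #{P ∈ S | 4 ≤ #(P.part x)} := by
    rw [← card_union_of_disjoint, ← card_union_of_disjoint]
    · congr 1
      ext P
      simp only [mem_union, mem_filter, ← and_or_left, iff_self_and]
      intro hP
      have := hS.two_le_card (by omega) hP (P.part_mem.2 (mem_univ x))
      omega
    · rw [disjoint_left]
      intro P
      simp only [mem_union, mem_filter]
      omega
    · rw [disjoint_left]
      intro P
      simp only [mem_filter]
      omega
  rw [hα] at hh
  generalize #{P ∈ S | #(P.part x) = 2} = d at *
  generalize #{P ∈ S | #(P.part x) = 3} = t at *
  generalize #{P ∈ S | 4 ≤ #(P.part x)} = L at *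
  by_contra! hlt
  have hm2 := hchoose m
  have hh2 := hchoose h
  -- With $d = m+j$ pairs at $x$ there remain $h = m-1-j$ unpaired points. For $j = L = 0$ the count
  -- allows exactly $\binom m2+1$ partitions, which is why two more than $\binom m2$ are assumed.
  obtain ⟨j, rfl⟩ : ∃ j, d = m + j := ⟨d - m, by omega⟩
  have hmj : (m : ℤ) = h + j + 1 := by omega
  zify at hT hcard hsplit
  have hm' : (5 : ℤ) ≤ m := by exact_mod_cast hm
  have hj : (0 : ℤ) ≤ j := by positivity
  have hh0 : (0 : ℤ) ≤ h := by positivity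
  have hsq : (m : ℤ) * (m - 1) = h * h + 2 * (h * j) + j * j + h + j := by
    rw [hmj]
    ring
  have hsq' : (h : ℤ) * (h - 1) = h * h - h := by ring
  have hlt' : (L : ℤ) < 2 * j + 2 := by omega
  have hj2 : (0 : ℤ) ≤ (j - 1) * (j - 2) := by
    rcases lt_or_ge j 2 with hj2 | hj2
    · interval_cases j <;> simp
    · have : (2 : ℤ) ≤ j := by exact_mod_cast hj2
      exact mul_nonneg (by linarith) (by linarith)
  rw [show ((j : ℤ) - 1) * (j - 2) = j * j - 3 * j + 2 by ring] at hj2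
  rcases Nat.eq_zero_or_pos L with rfl | hpos
  · push_cast at hsplit
    have hbound : 2 * ((h : ℤ) * j) + j * j + 2 ≤ 3 * j := by linarith
    have hprod : (h : ℤ) * j ≤ 0 := by linarith
    rcases Nat.eq_zero_or_pos h with rfl | hh1
    -- Here $j = m-1 \ge 4$, by `hm`.
    · have : (4 : ℤ) * j ≤ j * j := mul_le_mul_of_nonneg_right (by linarith) hj
      linarith [mul_nonneg hh0 hj]
    · have hh1' : (1 : ℤ) ≤ h := by exact_mod_cast hh1
      have : 1 * (j : ℤ) ≤ h * j := mul_le_mul_of_nonneg_right hh1' hj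
      linarith [mul_nonneg hj hj]
  · obtain ⟨h3, hT3⟩ := hL hpos
    zify at h3 hT3
    have : 3 * (j : ℤ) ≤ h * j := mul_le_mul_of_nonneg_right h3 hj
    linarith

-- Double count the weight $w$, which is $-2$ on pairs, $0$ on triples and $1$ on larger parts. The
-- bound $s\,w(s) \le 4(s-3)$, tight at $s = 2, 3, 4$, gives each partition total at most $4(2m-3k)
-- = -8$, while `hpt` gives each point at least $-2(m-1)$.
open Finset in
theorem eight_mul_card_le (hS : IsSpernerPartitionSystem k S) {m : ℕ} (h2 : 2 ≤ #S)
    (hα : Fintype.card α = 2 * m) (hk : 3 * k = 2 * m + 2)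
    (hpt : ∀ x : α, 2 * #{P ∈ S | #(P.part x) = 2} ≤ #{P ∈ S | 4 ≤ #(P.part x)} + 2 * (m - 1)) :
    8 * #S ≤ 4 * (m * (m - 1)) := by
  classical
  let w : ℕ → ℤ := fun s => (if 4 ≤ s then 1 else 0) - 2 * (if s = 2 then 1 else 0)
  have hw : ∀ s, 2 ≤ s → s * w s ≤ 4 * ((s : ℤ) - 3) := by
    intro s hs
    simp only [w]
    split_ifs <;> omega
  have hP : ∀ P ∈ S, ∑ x, w #(P.part x) ≤ -8 := by
    intro P hP
    have h1 : ∑ x, w #(P.part x) = ∑ A ∈ P.parts, #A * w #A := by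
      rw [← sum_fiberwise_of_maps_to (s := univ) (t := P.parts) (g := P.part)
        fun x _ => P.part_mem.2 (mem_univ x)]
      refine sum_congr rfl fun A hA => ?_
      have h3 : ({x | P.part x = A} : Finset α) = A := by
        ext x
        simp only [mem_filter, mem_univ, true_and]
        exact ⟨fun h => h ▸ P.mem_part (mem_univ x), fun h => P.part_eq_of_mem hA h⟩
      rw [sum_congr rfl (g := fun _ => w #A), sum_const, h3, nsmul_eq_mul]
      intro x hx
      rw [(mem_filter.1 hx).2]
    have h4 : ∑ A ∈ P.parts, (#A : ℤ) = 2 * m := by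
      have := P.sum_card_parts
      rw [card_univ, hα] at this
      exact_mod_cast this
    rw [h1]
    calc ∑ A ∈ P.parts, #A * w #A ≤ ∑ A ∈ P.parts, 4 * ((#A : ℤ) - 3) :=
          sum_le_sum fun A hA => hw _ (hS.two_le_card h2 hP hA)
      _ = 4 * (2 * m - 3 * k) := by
          rw [← mul_sum, sum_sub_distrib, h4, sum_const, hS.1 P hP, nsmul_eq_mul]
          ring
      _ ≤ -8 := by omega
  have hx : ∀ x : α, -(2 * ((m - 1 : ℕ) : ℤ)) ≤ ∑ P ∈ S, w #(P.part x) := by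
    intro x
    have := hpt x
    simp only [w, sum_sub_distrib, ← mul_sum, sum_boole]
    omega
  have h5 : -(4 * ((m : ℤ) * ((m - 1 : ℕ) : ℤ))) ≤ -8 * (#S : ℤ) :=
    calc -(4 * ((m : ℤ) * ((m - 1 : ℕ) : ℤ))) = ∑ _x : α, -(2 * ((m - 1 : ℕ) : ℤ)) := by
          rw [sum_const, card_univ, hα, nsmul_eq_mul]
          push_cast
          ring
      _ ≤ ∑ x : α, ∑ P ∈ S, w #(P.part x) := sum_le_sum fun x _ => hx x
      _ = ∑ P ∈ S, ∑ x : α, w #(P.part x) := sum_comm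
      _ ≤ ∑ _P ∈ S, -8 := sum_le_sum hP
      _ = -8 * (#S : ℤ) := by rw [sum_const, nsmul_eq_mul]; ring
  zify
  linarith

open Finset in
theorem card_le_choose_two_add_one (hS : IsSpernerPartitionSystem k S) {m : ℕ} (hm : 5 ≤ m)
    (hα : Fintype.card α = 2 * m) (hk : 3 * k = 2 * m + 2) : #S ≤ m.choose 2 + 1 := by
  by_contra! h
  have h1 := hS.eight_mul_card_le (by omega) hα hk
    (hS.two_mul_card_pairs_at_point_le hm hα h)
  have h2 : m * (m - 1) = 2 * m.choose 2 := by
    rw [Nat.choose_two_right, Nat.mul_div_cancel' (Nat.even_mul_pred_self m).two_dvd]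
  omega

end IsSpernerPartitionSystem

/-! ### Lower bound by doubling a Baranyai system. -/

open Finset in
/-- The partition of a finite type into the fibres of a surjective colouring. -/
def Finpartition.ofColouring {α β : Type*} [Fintype α] [DecidableEq α] [Fintype β] [DecidableEq β]
    (c : α → β) (hc : Function.Surjective c) : Finpartition (univ : Finset α) where
  parts := univ.image fun b => ({a | c a = b} : Finset α)
  supIndep := by
    rw [supIndep_iff_pairwiseDisjoint]
    intro A hA B hB hne
    simp only [coe_image, coe_univ, Set.image_univ, Set.mem_range] at hA hB
    obtain ⟨b, rfl⟩ := hA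
    obtain ⟨b', rfl⟩ := hB
    simp only [Function.onFun, id, disjoint_left, mem_filter, mem_univ, true_and]
    rintro a rfl rfl
    exact hne rfl
  sup_parts := by
    ext a
    simp
  bot_notMem := by
    simp only [bot_eq_empty, mem_image, mem_univ, true_and, not_exists]
    intro b h
    obtain ⟨a, rfl⟩ := hc b
    exact notMem_empty a (h ▸ by simp)

open Finset in
theorem le_SP_of_colourings {α ι : Type*} [Fintype α] [Fintype ι] {n k : ℕ}
    (hα : Fintype.card α = n) {β : Type*} [Fintype β] [Nonempty β] (hβ : Fintype.card β = k)
    (c : ι → α → β) (hc : ∀ i, Function.Surjective (c i))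
    (hsub : ∀ i i' b b', (∀ a, c i a = b → c i' a = b') → i = i') :
    Fintype.card ι ≤ SP n k := by
  classical
  let e : Fin n ≃ α := (Fintype.equivFinOfCardEq hα).symm
  let F : ι → Finpartition (univ : Finset (Fin n)) := fun i =>
    Finpartition.ofColouring (c i ∘ e) ((hc i).comp e.surjective)
  have hFsub : ∀ i i', ∀ A ∈ (F i).parts, ∀ B ∈ (F i').parts, A ⊆ B → i = i' := by
    intro i i' A hA B hB h
    obtain ⟨b, -, rfl⟩ := mem_image.1 hA
    obtain ⟨b', -, rfl⟩ := mem_image.1 hB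
    refine hsub i i' b b' fun a ha => ?_
    have := @h (e.symm a) (by simpa using ha)
    simpa using this
  have hFinj : Function.Injective F := by
    intro i i' h
    obtain ⟨b⟩ := ‹Nonempty β›
    have hA : ({a | (c i ∘ e) a = b} : Finset (Fin n)) ∈ (F i).parts :=
      mem_image_of_mem _ (mem_univ b)
    exact hFsub i i' _ hA _ (h ▸ hA) subset_rfl
  refine (SP_isGreatest n k).2 ⟨univ.image F, ⟨?_, ?_⟩, ?_⟩
  · intro P hP
    obtain ⟨i, -, rfl⟩ := mem_image.1 hP
    change #(univ.image fun b => ({a | (c i ∘ e) a = b} : Finset (Fin n))) = k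
    rw [card_image_of_injective, card_univ, hβ]
    intro b b' h
    obtain ⟨a, ha⟩ := ((hc i).comp e.surjective) b
    have h1 : a ∈ ({a | (c i ∘ e) a = b} : Finset (Fin n)) := by simpa using ha
    have h2 : a ∈ ({a | (c i ∘ e) a = b'} : Finset (Fin n)) := by
      have h' : ({a | (c i ∘ e) a = b} : Finset (Fin n)) = ({a | (c i ∘ e) a = b'} : Finset _) := h
      rwa [← h']
    exact ha.symm.trans (mem_filter.1 h2).2
  · intro P hP Q hQ hne A hA B hB h
    obtain ⟨i, -, rfl⟩ := mem_image.1 hP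
    obtain ⟨i', -, rfl⟩ := mem_image.1 hQ
    exact hne (congrArg F (hFsub i i' A hA B hB h))
  · rw [card_image_of_injective _ hFinj, card_univ]

open Finset in
/-- Two copies of a Baranyai partition of `m + 1` points lose their last point; the two pairs so
created, one in each copy, are recombined into two pairs across the copies. -/
theorem choose_two_le_SP {u m : ℕ} (hm : m + 1 = u * 3) :
    m.choose 2 ≤ SP (2 * m) (2 * u) := by
  classical
  have hu : 0 < u := by omega
  have hbaranyai := baranyai hu (r := 3) (by norm_num)
  rw [← hm] at hbaranyai
  obtain ⟨f, hcard, hinj⟩ : ∃ f : Fin (m.choose 2) → ℕ → Fin u,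
      (∀ i j, #(labelBlock (m + 1) (f i) j) = 3) ∧
      ∀ i j i' j', labelBlock (m + 1) (f i) j = labelBlock (m + 1) (f i') j' → i = i' := hbaranyai
  rw [← Fintype.card_fin (m.choose 2)]
  have : Nonempty (Fin u) := ⟨⟨0, hu⟩⟩
  -- The copy bit is flipped exactly at the larger surviving point of the block that loses `m`; this
  -- crosses its two pairs.
  let c : Fin (m.choose 2) → Fin m × Bool → Fin u × Bool := fun i p =>
    (f i p.1, xor p.2 (decide (f i p.1 = f i m ∧ ∃ y < (p.1 : ℕ), f i y = f i p.1)))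
  have hlift : ∀ i (x : Fin m) b, ∃ b', c i (x, b') = (f i x, b) := by
    intro i x b
    refine ⟨xor b (decide (f i x = f i m ∧ ∃ y < (x : ℕ), f i y = f i x)), ?_⟩
    simp only [c, Bool.xor_assoc, Bool.xor_self, Bool.xor_false]
  have hblock : ∀ i j, ∃ x y : Fin m, x < y ∧ f i x = j ∧ f i y = j := by
    intro i j
    have h1 : 1 < #((labelBlock (m + 1) (f i) j).erase m) := by
      have := pred_card_le_card_erase (s := labelBlock (m + 1) (f i) j) (a := m)
      rw [hcard] at this
      omega
    obtain ⟨x, hx, y, hy, hxy⟩ := one_lt_card.1 h1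
    simp only [mem_erase, mem_labelBlock] at hx hy
    rcases lt_or_gt_of_ne hxy with h | h
    · exact ⟨⟨x, by omega⟩, ⟨y, by omega⟩, h, hx.2.2, hy.2.2⟩
    · exact ⟨⟨y, by omega⟩, ⟨x, by omega⟩, h, hy.2.2, hx.2.2⟩
  refine le_SP_of_colourings (by simp [mul_comm]) (by simp [mul_comm]) c ?_ ?_
  · rintro i ⟨j, b⟩
    obtain ⟨x, -, -, rfl, -⟩ := hblock i j
    obtain ⟨b', h⟩ := hlift i x b
    exact ⟨_, h⟩
  · rintro i i' ⟨j, b⟩ ⟨j', b'⟩ hsub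
    have hproj : ∀ x < m, f i x = j → f i' x = j' := by
      intro x hx h
      obtain ⟨b₁, h1⟩ := hlift i ⟨x, hx⟩ b
      exact congrArg Prod.fst (hsub (⟨x, hx⟩, b₁) (h1.trans (by rw [h])))
    -- Otherwise the points of a crossed pair, which lie in different copies, would share a part
    -- contained in one copy.
    have hlast : f i m = j → f i' m = j' := by
      intro hj
      by_contra hj'
      obtain ⟨x₀, y, hxy₀, hx₀, hy⟩ := hblock i j
      obtain ⟨x, hxy, hx, hmin⟩ : ∃ x : Fin m, x < y ∧ f i x = j ∧ ∀ z < (x : ℕ), f i z ≠ j := by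
        have hex : ∃ z, f i z = j := ⟨x₀, hx₀⟩
        have hle : Nat.find hex ≤ x₀ := Nat.find_min' hex hx₀
        exact ⟨⟨Nat.find hex, hle.trans_lt x₀.2⟩, lt_of_le_of_lt hle hxy₀, Nat.find_spec hex,
          fun z hz => Nat.find_min hex hz⟩
      obtain ⟨b₁, h1⟩ := hlift i x b
      rw [hx] at h1
      obtain ⟨b₂, h2⟩ := hlift i y b
      rw [hy] at h2
      have hpx : ¬ f i' x = f i' m := by
        rw [hproj x x.2 hx]
        exact fun h => hj' h.symm
      have hpy : ¬ f i' y = f i' m := by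
        rw [hproj y y.2 hy]
        exact fun h => hj' h.symm
      have h3 := congrArg Prod.snd (hsub _ h1)
      have h4 := congrArg Prod.snd (hsub _ h2)
      simp only [c, hpx, hpy, false_and, decide_false, Bool.xor_false] at h3 h4
      have h5 := congrArg Prod.snd h1
      have h6 := congrArg Prod.snd h2
      have hx' : ¬ ∃ z < (x : ℕ), f i z = f i x := by
        rintro ⟨z, hz, h⟩
        exact hmin z hz (h.trans hx)
      have hy' : f i y = f i m ∧ ∃ z < (y : ℕ), f i z = f i y :=
        ⟨hy.trans hj.symm, x, hxy, hx.trans hy.symm⟩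
      simp only [c, hx', and_false, decide_false, Bool.xor_false] at h5
      simp only [c, decide_eq_true hy', Bool.xor_true] at h6
      rw [h3, ← h4, ← h6] at h5
      cases b₂ <;> simp at h5
    refine hinj i j i' j' (eq_of_subset_of_card_le ?_ (by rw [hcard, hcard]))
    intro x hx
    rw [mem_labelBlock] at hx ⊢
    refine ⟨hx.1, ?_⟩
    rcases Nat.lt_succ_iff_lt_or_eq.1 hx.1 with h | rfl
    · exact hproj x h hx.2
    · exact hlast hx.2

theorem theorem3 (n k : ℕ) (hk : 4 ≤ k) (hk_even : Even k) (hn : n = 3 * k - 2) :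
    SP n k = (n / 2).choose 2 ∨ SP n k = (n / 2).choose 2 + 1 := by
  obtain ⟨u, hu⟩ := hk_even
  obtain ⟨m, hm⟩ : ∃ m, m + 1 = u * 3 := ⟨u * 3 - 1, by omega⟩
  obtain rfl : k = 2 * u := by omega
  obtain rfl : n = 2 * m := by omega
  rw [Nat.mul_div_cancel_left m two_pos]
  have hlower := choose_two_le_SP hm
  obtain ⟨S, hS, hcard⟩ := (SP_isGreatest (2 * m) (2 * u)).1
  have hupper := hS.card_le_choose_two_add_one (m := m) (by omega) (by simp) (by omega)
  omega
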